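/- Let $\mathbb D$ be the open unit disc, $\mathbb T$ the unit circle, and $H^2$ the Hardy space, identified with a space of holomorphic functions on $\mathbb D$. Let $b$ be a rational function in the closed unit ball of $H^\infty$ with $\|b\|_\infty=1$ which is not inner (i.e. not a finite Blaschke product or unimodular constant), and let $\mathscr H(b)=(I-T_bT_b^*)^{1/2}H^2$ be the associated de Branges--Rovnyak space, where $T_b$ is the Toeplitz operator on $H^2$ with symbol $b$. Let $\tilde a$ be the Pythagorean mate of $b$, that is, the (rational) outer function with $|\tilde a|^2+|b|^2=1$ a.e. on $\mathbb T$ and $\tilde a(0)>0$. Let $\zeta_1,\dots,\zeta_n$ be the distinct zeros of $\tilde a$ on $\mathbb T$, with multiplicities $m_1,\dots,m_n$, put $a(z)=\prod_{i=1}^n(z-\zeta_i)^{m_i}$, and let $Z(a)=\{\zeta_1,\dots,\zeta_n\}$ be its zero set. For a function $f$ on $\mathbb D$, $f(\zeta_i)$ and $f^{(\ell)}(\zeta_i)$ denote non-tangential limits at $\zeta_i$ of $f$ and of its derivatives. Let $\varphi:\mathbb D\to\mathbb D$ be analytic and let $u$ be a function on $\mathbb D$ such that (H1) $u\in\mathscr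 H(b)$, and (H2) $u\varphi\in\mathscr H(b)$. Let $J$ be the set of those $j\in\{1,\dots,n\}$ for which $u^{(\ell)}(\zeta_j)\neq0$ for some $0\le\ell\le m_j-1$ and $\varphi$ has a non-tangential limit $\varphi(\zeta_j)\in\mathbb D$ at $\zeta_j$, and let $$w=\frac{u\cdot (a\circ\varphi)\cdot\prod_{j\in J}\bigl(\varphi-\varphi(\zeta_j)\bigr)^{m_j}}{a}\quad\text{on }\mathbb D.$$ Assume that $w\in H^2$. Then the following condition holds. (NC) For every $1\le i\le n$, either $u^{(\ell)}(\zeta_i)=0$ for all $0\le\ell\le m_i-1$, or there is an $\ell$ with $0\le\ell\le m_i-1$ such that $u^{(\ell)}(\zeta_i)\neq0$, and then $\varphi$ has a non-tangential limit $\varphi(\zeta_i)$ at $\zeta_i$, which satisfies $\varphi(\zeta_i)\in\mathbb D\cup Z(a)$. -/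

import Mathlib

open MeasureTheory Filter Topology Polynomial
open scoped ENNReal

noncomputable section

namespace DBR

/-! ### The unit disc, the Hardy space and Toeplitz operators -/

/-- The open unit disc. -/
def disc : Set ℂ := Metric.ball 0 1

/-- Normalized Lebesgue measure `m` on the unit circle, parametrized by
`t ↦ exp (2 π i t)` (`AddCircle.toCircle`) on `ℝ / ℤ`. -/
abbrev circleMeasure : Measure UnitAddCircle := AddCircle.haarAddCircle

/-- `L²` of the unit circle. -/
abbrev L2 : Type := Lp ℂ 2 circleMeasure

/-- `L^∞` of the unit circle. -/
abbrev LInf : Type := Lp ℂ ∞ circleMeasure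

/-- The Hardy space `H²`, as the closed subspace of those `f` in `L²` of the circle whose
negatively indexed Fourier coefficients vanish. -/
def H2 : Submodule ℂ L2 where
  carrier := {f | ∀ k : ℤ, k < 0 → fourierCoeff f k = 0}
  zero_mem' := fun k _ => by
    rw [← fourierBasis_repr (0 : L2)]; simp
  add_mem' := fun {f g} hf hg k hk => by
    rw [← fourierBasis_repr, map_add, lp.coeFn_add, Pi.add_apply, fourierBasis_repr,
      fourierBasis_repr, hf k hk, hg k hk, add_zero]
  smul_mem' := fun c f hf k hk => by
    rw [← fourierBasis_repr, map_smul, lp.coeFn_smul, Pi.smul_apply, fourierBasis_repr,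
      hf k hk, smul_zero]

theorem isClosed_H2 : IsClosed (H2 : Set L2) := by
  have h : (H2 : Set L2) = ⋂ k : ℤ, ⋂ _ : k < 0,
      {f : L2 | inner ℂ (fourierBasis (T := 1) k) f = 0} := by
    ext f
    simp only [Set.mem_iInter, Set.mem_ofPred_eq]
    refine forall₂_congr fun k _ => ?_
    rw [← fourierBasis_repr, HilbertBasis.repr_apply_apply]
  rw [h]
  exact isClosed_iInter fun k => isClosed_iInter fun _ =>
    isClosed_eq (continuous_const.inner continuous_id) continuous_const

instance : CompleteSpace H2 := isClosed_H2.completeSpace_coe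

/-- The Toeplitz operator `T_ψ f = P₊ (ψ f)` on `H²` with symbol `ψ ∈ L^∞`, where `P₊` is the
orthogonal projection of `L²` onto `H²`. -/
def toeplitz (ψ : LInf) : H2 →L[ℂ] H2 :=
  H2.orthogonalProjectionOnto ∘L
    ((ContinuousLinearMap.mul ℂ ℂ).holderL circleMeasure ∞ 2 2 ψ) ∘L H2.subtypeL

/-- The function `F`, on the open unit disc, is the holomorphic function whose Taylor coefficients
are the Fourier coefficients of `h ∈ H²`. -/
def Represents (F : ℂ → ℂ) (h : H2) : Prop :=
  ∀ z ∈ disc, HasSum (fun k : ℕ => fourierCoeff (h : L2) k * z ^ k) (F z)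

/-- `F` (only its values on the open unit disc matter) belongs to the Hardy space `H²`, viewed as
a space of holomorphic functions on the disc. -/
def MemH2 (F : ℂ → ℂ) : Prop := ∃ h : H2, Represents F h

/-! ### Rational symbols and de Branges--Rovnyak spaces -/

/-- The value at `z ∈ ℂ` of a rational function (in lowest terms). -/
def val (R : RatFunc ℂ) (z : ℂ) : ℂ := R.eval (RingHom.id ℂ) z

/-- The restriction of a rational function to the unit circle. -/
def onCircle (R : RatFunc ℂ) (t : UnitAddCircle) : ℂ := val R (AddCircle.toCircle t)

/-- `b` is a rational function in the closed unit ball of `H^∞` with `‖b‖_∞ = 1` which is not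
inner. A rational function which is bounded on the disc has no pole in the closed disc. -/
structure IsSymbol (b : RatFunc ℂ) : Prop where
  norm_eq_one : IsLUB ((fun z => ‖val b z‖) '' disc) 1
  not_inner : ¬ ∀ᵐ t ∂circleMeasure, ‖onCircle b t‖ = 1

theorem norm_onCircle_le {b : RatFunc ℂ} (hb : IsSymbol b) (t : UnitAddCircle) :
    ‖onCircle b t‖ ≤ 1 := by
  unfold onCircle
  set ζ : ℂ := (AddCircle.toCircle t : ℂ) with hζ
  have hn : ‖ζ‖ = 1 := Circle.norm_coe _
  by_cases hd : b.denom.eval ζ = 0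
  · simp [val, RatFunc.eval, Polynomial.eval₂_id, hd]
  · have hc : ContinuousAt (fun z => ‖val b z‖) ζ := by
      unfold val RatFunc.eval
      simp only [Polynomial.eval₂_id]
      exact (b.num.continuous.continuousAt.div b.denom.continuous.continuousAt hd).norm
    have hcl : ζ ∈ closure disc := by
      rw [disc, closure_ball _ one_ne_zero]; simp [hn]
    have : (𝓝[disc] ζ).NeBot := mem_closure_iff_nhdsWithin_neBot.1 hcl
    exact le_of_tendsto (hc.tendsto.mono_left nhdsWithin_le_nhds)
      (eventually_mem_nhdsWithin.mono fun z hz =>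
        hb.norm_eq_one.1 (Set.mem_image_of_mem _ hz))

/-- The boundary values of a symbol `b` are bounded and measurable. -/
theorem memLp_onCircle {b : RatFunc ℂ} (hb : IsSymbol b) :
    MemLp (onCircle b) ∞ circleMeasure := by
  refine memLp_top_of_bound ?_ 1 (Eventually.of_forall (norm_onCircle_le hb))
  have hm : Measurable (fun t : UnitAddCircle => (AddCircle.toCircle t : ℂ)) :=
    (continuous_subtype_val.comp AddCircle.continuous_toCircle).measurable
  refine Measurable.aestronglyMeasurable ?_
  unfold onCircle val RatFunc.eval
  simp only [Polynomial.eval₂_id]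
  exact (b.num.continuous.measurable.comp hm).div (b.denom.continuous.measurable.comp hm)

open Classical in
/-- The element of `L^∞` given by the boundary values of a rational function (the value `0` is used
if these are not essentially bounded; see `memLp_onCircle` for the symbols `b`). -/
def boundary (R : RatFunc ℂ) : LInf :=
  if h : MemLp (onCircle R) ∞ circleMeasure then h.toLp else 0

/-- The operator `(I - T T^*)^{1/2}` on a Hilbert space, for a contraction `T`. -/
def defectOp {H : Type*} [NormedAddCommGroup H] [InnerProductSpace ℂ H] [CompleteSpace H]
    (T : H →L[ℂ] H) : H →L[ℂ] H :=
  CFC.sqrt (1 - T * ContinuousLinearMap.adjoint T)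

/-- The de Branges--Rovnyak space `ℋ(b)` as a set: the range of `(I - T_b T_b^*)^{1/2}` on `H²`. -/
def dBRSpace (b : RatFunc ℂ) : Set H2 := Set.range (defectOp (toeplitz (boundary b)))

/-- `F` (only its values on the open unit disc matter) belongs to `ℋ(b)`, viewed as
a space of holomorphic functions on the disc. -/
def MemHb (b : RatFunc ℂ) (F : ℂ → ℂ) : Prop := ∃ h ∈ dBRSpace b, Represents F h

/-- A rational function `A` is outer: `log |A|` is integrable on the circle and, up to a unimodular
constant, `A` is the exponential of the Herglotz integral of `log |A|` in the disc. -/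
def IsOuter (A : RatFunc ℂ) : Prop :=
  Integrable (fun t => Real.log ‖onCircle A t‖) circleMeasure ∧
  ∃ c : ℂ, ‖c‖ = 1 ∧ ∀ z ∈ disc,
    val A z = c * Complex.exp (∫ t : UnitAddCircle,
      ((AddCircle.toCircle t : ℂ) + z) / ((AddCircle.toCircle t : ℂ) - z) *
        (Real.log ‖onCircle A t‖ : ℂ) ∂circleMeasure)

/-- `A` is the Pythagorean mate of `b`: `A` is outer, `|A|² + |b|² = 1` a.e. on the circle and
`A(0) > 0`. -/
structure IsPythagoreanMate (b A : RatFunc ℂ) : Prop where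
  outer : IsOuter A
  norm_sq_add : ∀ᵐ t ∂circleMeasure, ‖onCircle A t‖ ^ 2 + ‖onCircle b t‖ ^ 2 = 1
  pos : ∃ r : ℝ, 0 < r ∧ val A 0 = r

open Classical in
/-- The zeros `ζ₁, …, ζₙ` on the unit circle of a rational function. -/
def circleZeros (A : RatFunc ℂ) : Finset ℂ := A.num.roots.toFinset.filter fun ζ => ‖ζ‖ = 1

/-- The multiplicity of `ζ` as a zero of a rational function. -/
def mult (A : RatFunc ℂ) (ζ : ℂ) : ℕ := A.num.rootMultiplicity ζ

/-- The polynomial `a = ∏ᵢ (z - ζᵢ) ^ mᵢ`. -/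
def aPoly (A : RatFunc ℂ) : ℂ[X] := ∏ ζ ∈ circleZeros A, (X - C ζ) ^ mult A ζ

/-! ### Non-tangential limits, the weight and the condition -/

/-- The non-tangential approach region `{z ∈ 𝔻 : |z - ζ| < M (1 - |z|)}` at `ζ`. -/
def stolz (ζ : ℂ) (M : ℝ) : Set ℂ := {z | z ∈ disc ∧ ‖z - ζ‖ < M * (1 - ‖z‖)}

/-- `f` has the non-tangential limit `L` at the point `ζ` of the unit circle. -/
def HasNTLimit (f : ℂ → ℂ) (ζ L : ℂ) : Prop :=
  ∀ M : ℝ, 1 < M → Tendsto f (𝓝[stolz ζ M] ζ) (𝓝 L)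

open Classical in
/-- The value `f(ζ)` in the sense of non-tangential limits (`0` if there is no such limit). -/
def ntLimit (f : ℂ → ℂ) (ζ : ℂ) : ℂ := if h : ∃ L, HasNTLimit f ζ L then h.choose else 0

/-- Non-tangential limits at points of the unit circle are unique. -/
theorem HasNTLimit.unique {f : ℂ → ℂ} {ζ L L' : ℂ} (hζ : ‖ζ‖ = 1) (h : HasNTLimit f ζ L)
    (h' : HasNTLimit f ζ L') : L = L' := by
  have hcl : ζ ∈ closure (stolz ζ 2) := by
    refine mem_closure_of_tendsto (f := fun r : ℝ => (r : ℂ) * ζ) (b := 𝓝[<] (1 : ℝ)) ?_ ?_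
    · have : ContinuousAt (fun r : ℝ => (r : ℂ) * ζ) 1 := by fun_prop
      simpa using this.tendsto.mono_left nhdsWithin_le_nhds
    · filter_upwards [Ioo_mem_nhdsLT (zero_lt_one' ℝ)] with r hr
      have h1 : ‖(r : ℂ) * ζ‖ = r := by simp [hζ, abs_of_pos hr.1]
      have h2 : ‖(r : ℂ) * ζ - ζ‖ = 1 - r := by
        rw [← sub_one_mul, norm_mul, hζ, mul_one, ← Complex.ofReal_one, ← Complex.ofReal_sub,
          Complex.norm_real, Real.norm_eq_abs, abs_sub_comm, abs_of_pos (by linarith [hr.2])]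
      refine ⟨by simpa [disc, hζ, abs_of_pos hr.1] using hr.2, ?_⟩
      rw [h1, h2]; linarith [hr.2]
  have : (𝓝[stolz ζ 2] ζ).NeBot := mem_closure_iff_nhdsWithin_neBot.1 hcl
  exact tendsto_nhds_unique (h 2 (by norm_num)) (h' 2 (by norm_num))

theorem HasNTLimit.ntLimit_eq {f : ℂ → ℂ} {ζ L : ℂ} (hζ : ‖ζ‖ = 1) (h : HasNTLimit f ζ L) :
    ntLimit f ζ = L := by
  have hex : ∃ L, HasNTLimit f ζ L := ⟨L, h⟩
  rw [ntLimit, dif_pos hex]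
  exact hex.choose_spec.unique hζ h

/-- `u^{(ℓ)}(ζ)` exists as a non-tangential limit and is nonzero for some `0 ≤ ℓ ≤ m - 1`. -/
def HasNonzeroDeriv (u : ℂ → ℂ) (ζ : ℂ) (m : ℕ) : Prop :=
  ∃ l < m, ∃ c : ℂ, c ≠ 0 ∧ HasNTLimit (iteratedDeriv l u) ζ c

open Classical in
/-- The points `ζᵢ` at which some `u^{(ℓ)}(ζᵢ)`, `0 ≤ ℓ ≤ mᵢ - 1`, is nonzero and `φ` has a
non-tangential limit in the open disc (the points `ζ_{p+1}, …, ζₙ`). -/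
def interiorZeros (A : RatFunc ℂ) (u φ : ℂ → ℂ) : Finset ℂ :=
  (circleZeros A).filter fun ζ =>
    HasNonzeroDeriv u ζ (mult A ζ) ∧ ∃ L ∈ disc, HasNTLimit φ ζ L

/-- The weight `w = u · (a ∘ φ) · ∏_{j > p} (φ - φ(ζⱼ)) ^ mⱼ / a`. -/
def weight (A : RatFunc ℂ) (u φ : ℂ → ℂ) (z : ℂ) : ℂ :=
  u z * (aPoly A).eval (φ z) *
    (∏ ζ ∈ interiorZeros A u φ, (φ z - ntLimit φ ζ) ^ mult A ζ) / (aPoly A).eval z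

/-- The condition (NC): for each `i`, either all `u^{(ℓ)}(ζᵢ)`, `0 ≤ ℓ ≤ mᵢ - 1`, vanish, or one of
them is nonzero and then `φ` has a non-tangential limit at `ζᵢ`, lying in `𝔻 ∪ Z(a)`. -/
def ConditionNC (A : RatFunc ℂ) (u φ : ℂ → ℂ) : Prop :=
  ∀ ζ ∈ circleZeros A,
    (∀ l < mult A ζ, HasNTLimit (iteratedDeriv l u) ζ 0) ∨
    (HasNonzeroDeriv u ζ (mult A ζ) ∧
      ∃ L, HasNTLimit φ ζ L ∧ L ∈ disc ∪ {x | (aPoly A).eval x = 0})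

end DBR

end

noncomputable section

namespace DBR

/-! Near a zero ζ of `A` on the circle, of order m, every F in ℋ(b) is a polynomial plus o(|z -
ζ|^(m-1)) non-tangentially; the condition is then read off from leading terms.

For the expansion, clear denominators: |P|² + |Q|² = |d|² on the circle, with b = P/d and A = Q/d.
For f = (I - T T*)^(1/2) k this identity gives |⟨f, P x⟩| ≤ ‖k‖ ‖Q x‖ for all polynomials x, so by
duality P* f = Q* g for some g in H² (`exists_inner_mul_eq`). In Taylor coefficients this says that
P♯ F - Q♯ G is a polynomial, where ♯ conjugates and reverses coefficients
(`exists_polynomial_of_inner_eq`). At ζ, Q♯ vanishes to order m and P♯ does not vanish, while (z -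
ζ) G → 0 by the growth of H² functions (`MemHb.exists_isLittleO`). Cauchy estimates turn the
expansion into limits of derivatives.

If some derivative of u is nonzero at ζ, then u ~ c (z - ζ)^k with c ≠ 0 and k < m. Since |u φ| ≤
|u|, the expansion of u φ starts no earlier, so φ = (u φ)/u has a limit L with |L| ≤ 1
(`exists_hasNTLimit`). If |L| = 1, then w a / (z - ζ)^k tends to 0 because w ∈ H², and also to c ·
a(L) times a nonzero product; hence a(L) = 0 (`eval_aPoly_eq_zero_of_memH2`). -/

/-! ### Polynomials as elements of H² -/

theorem norm_sq_eq_integral (f : L2) : ‖f‖ ^ 2 = ∫ t, ‖f t‖ ^ 2 ∂circleMeasure := by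
  have h := inner_self_eq_norm_sq_to_K (𝕜 := ℂ) f
  rw [L2.inner_def] at h
  have h2 : (fun t => inner ℂ (f t) (f t)) = fun t => ((‖f t‖ ^ 2 : ℝ) : ℂ) := by
    funext t
    rw [inner_self_eq_norm_sq_to_K]
    simp
  have h3 : ∫ t, ((‖f t‖ ^ 2 : ℝ) : ℂ) ∂circleMeasure =
      ((∫ t, ‖f t‖ ^ 2 ∂circleMeasure : ℝ) : ℂ) := integral_ofReal
  rw [h2, h3] at h
  exact Complex.ofReal_injective ((Complex.ofReal_pow _ _).trans h.symm)

/-- The restriction of a polynomial to the circle, as a continuous function. -/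
def polyCircle : ℂ[X] →ₗ[ℂ] C(UnitAddCircle, ℂ) where
  toFun p := ⟨fun t => p.eval (AddCircle.toCircle t : ℂ),
    p.continuous.comp (continuous_subtype_val.comp AddCircle.continuous_toCircle)⟩
  map_add' p q := by ext t; simp
  map_smul' c p := by ext t; simp

@[simp]
theorem polyCircle_apply (p : ℂ[X]) (t : UnitAddCircle) :
    polyCircle p t = p.eval (AddCircle.toCircle t : ℂ) := rfl

/-- A polynomial as an element of `L²` of the circle. -/
def polyL2 : ℂ[X] →ₗ[ℂ] L2 :=
  (ContinuousMap.toLp 2 circleMeasure ℂ).toLinearMap ∘ₗ polyCircle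

theorem coeFn_polyL2 (p : ℂ[X]) :
    polyL2 p =ᵐ[circleMeasure] fun t => p.eval (AddCircle.toCircle t : ℂ) :=
  ContinuousMap.coeFn_toLp (𝕜 := ℂ) circleMeasure (polyCircle p)

theorem polyL2_monomial (k : ℕ) (c : ℂ) :
    polyL2 (monomial k c) = c • fourierLp (T := 1) 2 (k : ℤ) := by
  have h : polyCircle (monomial k c) = c • fourier (T := 1) (k : ℤ) := by
    ext t
    simp [fourier_apply, AddCircle.toCircle_nsmul]
  change ContinuousMap.toLp 2 circleMeasure ℂ (polyCircle (monomial k c)) = _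
  rw [h, map_smul]

theorem fourierCoeff_eq_inner (f : L2) (k : ℤ) :
    fourierCoeff f k = inner ℂ (fourierLp (T := 1) 2 k) f := by
  rw [← fourierBasis_repr, HilbertBasis.repr_apply_apply, coe_fourierBasis]

theorem polyL2_mem_H2 (p : ℂ[X]) : polyL2 p ∈ H2 := by
  induction p using Polynomial.induction_on' with
  | add p q hp hq => rw [map_add]; exact H2.add_mem hp hq
  | monomial n c =>
    rw [polyL2_monomial]
    refine H2.smul_mem _ fun k hk => ?_
    rw [fourierCoeff_eq_inner]
    exact orthonormal_fourier.2 (by omega)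

/-- A polynomial as an element of `H²`. -/
def polyH2 : ℂ[X] →ₗ[ℂ] H2 := polyL2.codRestrict H2 polyL2_mem_H2

@[simp]
theorem coe_polyH2 (p : ℂ[X]) : (polyH2 p : L2) = polyL2 p := rfl

/-- The inner product with a polynomial, in terms of coefficients. -/
theorem inner_polyH2 (p : ℂ[X]) (f : H2) {n : ℕ} (hn : p.natDegree < n) :
    inner ℂ (polyH2 p) f =
      ∑ j ∈ Finset.range n, starRingEnd ℂ (p.coeff j) * fourierCoeff (f : L2) j := by
  rw [Submodule.coe_inner, coe_polyH2]
  conv_lhs => rw [p.as_sum_range' n hn]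
  rw [map_sum, sum_inner]
  refine Finset.sum_congr rfl fun j _ => ?_
  rw [polyL2_monomial, inner_smul_left, fourierCoeff_eq_inner]

theorem norm_sq_polyH2 (p : ℂ[X]) :
    ‖polyH2 p‖ ^ 2 = ∫ t, ‖p.eval (AddCircle.toCircle t : ℂ)‖ ^ 2 ∂circleMeasure := by
  rw [← Submodule.norm_coe, coe_polyH2, norm_sq_eq_integral]
  exact integral_congr_ae ((coeFn_polyL2 p).mono fun t ht => by simp only [ht])

theorem norm_sq_polyH2_add {P Q d : ℂ[X]}
    (h : ∀ z : ℂ, ‖z‖ = 1 → ‖P.eval z‖ ^ 2 + ‖Q.eval z‖ ^ 2 = ‖d.eval z‖ ^ 2) (x : ℂ[X]) :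
    ‖polyH2 (P * x)‖ ^ 2 + ‖polyH2 (Q * x)‖ ^ 2 = ‖polyH2 (d * x)‖ ^ 2 := by
  have hi : ∀ p : ℂ[X], Integrable
      (fun t => ‖p.eval (AddCircle.toCircle t : ℂ)‖ ^ 2) circleMeasure := fun p =>
    (((polyCircle p).continuous.norm.pow 2).integrable_of_hasCompactSupport
      (HasCompactSupport.of_compactSpace _))
  rw [norm_sq_polyH2, norm_sq_polyH2, norm_sq_polyH2, ← integral_add (hi _) (hi _)]
  refine integral_congr_ae (Eventually.of_forall fun t => ?_)
  simp only [eval_mul, norm_mul, mul_pow]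
  rw [← h _ (Circle.norm_coe _)]
  ring

/-! ### Duality for the range of the defect operator -/

/-- Range of `(1 - T T^*)^{1/2}`: testing against vectors. -/
theorem norm_inner_defectOp_sq_le {H : Type*} [NormedAddCommGroup H] [InnerProductSpace ℂ H]
    [CompleteSpace H] {T : H →L[ℂ] H} (hT : ‖T‖ ≤ 1) (h k : H) :
    ‖inner ℂ k (defectOp T h)‖ ^ 2 ≤
      ‖h‖ ^ 2 * (‖k‖ ^ 2 - ‖ContinuousLinearMap.adjoint T k‖ ^ 2) := by
  -- Positivity is what makes `CFC.sqrt` a genuine square root here, so that `defectOp T` squares to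
  -- 1 - T T*.
  have hpos : 0 ≤ 1 - T * ContinuousLinearMap.adjoint T := by
    have h1 : ‖T * star T‖ ≤ 1 := by
      rw [CStarRing.norm_self_mul_star]
      nlinarith [norm_nonneg T]
    exact sub_nonneg.2 ((CStarAlgebra.norm_le_one_iff_of_nonneg _ (mul_star_self_nonneg T)).1 h1)
  have hD : defectOp T * defectOp T = 1 - T * ContinuousLinearMap.adjoint T :=
    CFC.sqrt_mul_sqrt_self _ hpos
  have hsa : ContinuousLinearMap.adjoint (defectOp T) = defectOp T :=
    (IsSelfAdjoint.of_nonneg (CFC.sqrt_nonneg _)).star_eq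
  have hn : ‖defectOp T k‖ ^ 2 = ‖k‖ ^ 2 - ‖ContinuousLinearMap.adjoint T k‖ ^ 2 := by
    have e1 : inner ℂ (defectOp T k) (defectOp T k) =
        inner ℂ k k - inner ℂ (ContinuousLinearMap.adjoint T k)
          (ContinuousLinearMap.adjoint T k) := by
      rw [ContinuousLinearMap.adjoint_inner_left, ← inner_sub_right]
      have e2 : defectOp T (defectOp T k) = k - T (ContinuousLinearMap.adjoint T k) :=
        congrArg (fun S : H →L[ℂ] H => S k) hD
      have e3 := ContinuousLinearMap.adjoint_inner_right (defectOp T) k (defectOp T k)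
      rw [hsa] at e3
      rw [← e2, e3]
    simp only [inner_self_eq_norm_sq_to_K] at e1
    exact_mod_cast e1
  rw [← hn, ← ContinuousLinearMap.adjoint_inner_left, hsa, ← mul_pow]
  have := norm_inner_le_norm (𝕜 := ℂ) (defectOp T k) h
  gcongr
  linarith

/-- A functional dominated by `‖σ x‖` factors through `σ`. -/
theorem exists_inner_eq_of_le {V H : Type*} [AddCommGroup V] [Module ℂ V] [NormedAddCommGroup H]
    [InnerProductSpace ℂ H] [CompleteSpace H] (σ τ : V →ₗ[ℂ] H) (f : H) (C : ℝ)
    (hC : ∀ x, ‖inner ℂ f (τ x)‖ ≤ C * ‖σ x‖) :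
    ∃ g : H, ∀ x, inner ℂ g (σ x) = inner ℂ f (τ x) := by
  -- A linear section s of σ, with no continuity needed: y ↦ ⟨f, τ (s y)⟩ is bounded by C on the
  -- range of σ, extends by Hahn–Banach, and is represented by Riesz. By `hC` the functional ⟨f, τ
  -- ·⟩ kills ker σ, so the choice of s is immaterial.
  obtain ⟨s, hs⟩ := LinearMap.exists_rightInverse_of_surjective σ.rangeRestrict
    σ.range_rangeRestrict
  have hs' : ∀ y : LinearMap.range σ, σ (s y) = y := fun y =>
    congrArg Subtype.val (LinearMap.congr_fun hs y)
  obtain ⟨Λ, hΛ, -⟩ := exists_extension_norm_eq (LinearMap.range σ)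
    (LinearMap.mkContinuous ((innerSL ℂ f).toLinearMap ∘ₗ τ ∘ₗ s) C fun y => by
      have := hC (s y)
      rwa [hs'] at this)
  refine ⟨(InnerProductSpace.toDual ℂ H).symm Λ, fun x => ?_⟩
  rw [InnerProductSpace.toDual_symm_apply]
  have h1 : Λ (σ x) = inner ℂ f (τ (s ⟨σ x, x, rfl⟩)) := hΛ ⟨σ x, x, rfl⟩
  rw [h1, ← sub_eq_zero, ← inner_sub_right, ← map_sub, ← norm_le_zero_iff]
  refine (hC _).trans_eq ?_
  rw [map_sub, hs']
  simp

/-- If `f` lies in the range of `(1 - T T^*)^{1/2}` and `T (d x) = P x` for polynomials `x`, where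
`|P|² + |Q|² = |d|²` on the circle, then `P^* f = Q^* g` for some `g ∈ H²`. -/
theorem exists_inner_mul_eq {T : H2 →L[ℂ] H2} (hT : ‖T‖ ≤ 1) {P Q d : ℂ[X]}
    (hTd : ∀ x, T (polyH2 (d * x)) = polyH2 (P * x))
    (h : ∀ z : ℂ, ‖z‖ = 1 → ‖P.eval z‖ ^ 2 + ‖Q.eval z‖ ^ 2 = ‖d.eval z‖ ^ 2)
    {f : H2} (hf : f ∈ Set.range (defectOp T)) :
    ∃ g : H2, ∀ x, inner ℂ (polyH2 (Q * x)) g = inner ℂ (polyH2 (P * x)) f := by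
  obtain ⟨k, rfl⟩ := hf
  have key : ∀ x, ‖polyH2 (P * x)‖ ^ 2 -
      ‖ContinuousLinearMap.adjoint T (polyH2 (P * x))‖ ^ 2 ≤ ‖polyH2 (Q * x)‖ ^ 2 := by
    intro x
    have e := norm_sq_polyH2_add h x
    -- Since T (d x) = P x, the left side is ⟨T* (P x), d x⟩; apply Cauchy–Schwarz.
    have h1 : ‖polyH2 (P * x)‖ ^ 2 ≤
        ‖ContinuousLinearMap.adjoint T (polyH2 (P * x))‖ * ‖polyH2 (d * x)‖ := by
      have h2 := norm_inner_le_norm (𝕜 := ℂ) (ContinuousLinearMap.adjoint T (polyH2 (P * x)))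
        (polyH2 (d * x))
      rw [ContinuousLinearMap.adjoint_inner_left, hTd, inner_self_eq_norm_sq_to_K] at h2
      simpa using h2
    set p := ‖polyH2 (P * x)‖
    set q := ‖polyH2 (Q * x)‖
    set r := ‖ContinuousLinearMap.adjoint T (polyH2 (P * x))‖
    set D := ‖polyH2 (d * x)‖
    -- If r² < p² - q², then r² D² < (p² - q²)(p² + q²) ≤ p⁴, against p² ≤ r D.
    by_contra! hlt
    have h3 : (p ^ 2) ^ 2 ≤ r ^ 2 * D ^ 2 := by
      rw [← mul_pow]; gcongr
    have hD : 0 < D ^ 2 := by nlinarith [sq_nonneg q, sq_nonneg r]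
    nlinarith [mul_lt_mul_of_pos_right hlt hD, sq_nonneg (q ^ 2)]
  obtain ⟨g, hg⟩ := exists_inner_eq_of_le (polyH2 ∘ₗ LinearMap.mulLeft ℂ Q)
    (polyH2 ∘ₗ LinearMap.mulLeft ℂ P) (defectOp T k) ‖k‖ fun x => by
      refine (sq_le_sq₀ (norm_nonneg _) (by positivity)).1 ?_
      simp only [LinearMap.comp_apply, LinearMap.mulLeft_apply]
      have e := norm_inner_symm (𝕜 := ℂ) (defectOp T k) (polyH2 (P * x))
      refine ((congrArg (· ^ 2) e).trans_le (norm_inner_defectOp_sq_le hT k _)).trans ?_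
      rw [mul_pow]
      exact mul_le_mul_of_nonneg_left (key x) (by positivity)
  refine ⟨g, fun x => ?_⟩
  rw [← inner_conj_symm (𝕜 := ℂ) (polyH2 (Q * x)), ← inner_conj_symm (𝕜 := ℂ) (polyH2 (P * x))]
  exact congrArg _ (hg x)

/-! ### The Toeplitz operator of b and the Pythagorean identity -/

theorem norm_toeplitz_le (ψ : LInf) : ‖toeplitz ψ‖ ≤ ‖ψ‖ := by
  refine ContinuousLinearMap.opNorm_le_bound _ (norm_nonneg _) fun y => ?_
  have h1 : ‖((ContinuousLinearMap.mul ℂ ℂ).holderL circleMeasure ∞ 2 2 ψ) (y : L2)‖ ≤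
      ‖ContinuousLinearMap.mul ℂ ℂ‖ * ‖ψ‖ * ‖(y : L2)‖ :=
    ContinuousLinearMap.norm_holder_apply_apply_le _ ψ (y : L2)
  rw [ContinuousLinearMap.opNorm_mul, one_mul] at h1
  exact (H2.norm_orthogonalProjectionOnto_apply_le _).trans h1

theorem norm_boundary_le {b : RatFunc ℂ} (hb : IsSymbol b) : ‖boundary b‖ ≤ 1 := by
  rw [boundary, dif_pos (memLp_onCircle hb), Lp.norm_toLp]
  refine ENNReal.toReal_le_of_le_ofReal zero_le_one ?_
  rw [eLpNorm_exponent_top]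
  exact eLpNormEssSup_le_of_ae_bound (Eventually.of_forall (norm_onCircle_le hb))

theorem exists_toCircle_eq {z : ℂ} (hz : ‖z‖ = 1) :
    ∃ t : UnitAddCircle, (AddCircle.toCircle t : ℂ) = z := by
  obtain ⟨t, ht⟩ := (AddCircle.homeomorphCircle (T := 1) one_ne_zero).surjective
    ⟨z, mem_sphere_zero_iff_norm.2 hz⟩
  refine ⟨t, ?_⟩
  rw [AddCircle.homeomorphCircle_apply] at ht
  rw [ht]

/-- A connected nontrivial group has no isolated points, so that its Haar measure has no atoms. -/
instance : Nontrivial UnitAddCircle := by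
  obtain ⟨s, hs⟩ := exists_toCircle_eq (z := 1) (by simp)
  obtain ⟨t, ht⟩ := exists_toCircle_eq (z := -1) (by simp)
  refine ⟨s, t, fun h => ?_⟩
  rw [h, ht] at hs
  norm_num at hs

theorem finite_preimage_toCircle_roots {p : ℂ[X]} (hp : p ≠ 0) :
    {t : UnitAddCircle | p.eval (AddCircle.toCircle t : ℂ) = 0}.Finite := by
  have h := (p.rootSet_finite ℂ).preimage (f := fun t : UnitAddCircle =>
    (AddCircle.toCircle t : ℂ)) (Function.Injective.injOn
      (Subtype.val_injective.comp (AddCircle.injective_toCircle one_ne_zero)))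
  refine h.subset fun t ht => ?_
  simpa [mem_rootSet, hp, Polynomial.aeval_def, eval₂_eq_eval_map] using ht

/-- A nonzero polynomial vanishes almost nowhere on the circle. -/
theorem ae_eval_toCircle_ne_zero {p : ℂ[X]} (hp : p ≠ 0) :
    ∀ᵐ t ∂circleMeasure, p.eval (AddCircle.toCircle t : ℂ) ≠ 0 := by
  have : ConnectedSpace UnitAddCircle := by infer_instance
  have : (𝓝[≠] (0 : UnitAddCircle)).NeBot := by infer_instance
  rw [ae_iff]
  simpa using (finite_preimage_toCircle_roots hp).measure_zero circleMeasure

theorem onCircle_eq (R : RatFunc ℂ) (t : UnitAddCircle) :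
    onCircle R t =
      R.num.eval (AddCircle.toCircle t : ℂ) / R.denom.eval (AddCircle.toCircle t : ℂ) := by
  simp [onCircle, val, RatFunc.eval, eval₂_id]

/-- Multiplying by the denominator keeps the product with b analytic, so the projection onto H² acts
trivially. -/
theorem toeplitz_polyH2 {b : RatFunc ℂ} (hb : IsSymbol b) (x : ℂ[X]) :
    toeplitz (boundary b) (polyH2 (b.denom * x)) = polyH2 (b.num * x) := by
  have h : ((ContinuousLinearMap.mul ℂ ℂ).holderL circleMeasure ∞ 2 2 (boundary b))
      (polyL2 (b.denom * x)) = polyL2 (b.num * x) := by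
    refine Lp.ext ?_
    refine ((ContinuousLinearMap.mul ℂ ℂ).coeFn_holder (r := 2) (boundary b)
      (polyL2 (b.denom * x))).trans ?_
    have hbd : boundary b =ᵐ[circleMeasure] onCircle b := by
      rw [boundary, dif_pos (memLp_onCircle hb)]
      exact (memLp_onCircle hb).coeFn_toLp
    filter_upwards [hbd, coeFn_polyL2 (b.denom * x), coeFn_polyL2 (b.num * x),
      ae_eval_toCircle_ne_zero b.denom_ne_zero] with t h1 h2 h3 h4
    rw [h1, h2, h3, ContinuousLinearMap.mul_apply', onCircle_eq, eval_mul, eval_mul]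
    field_simp
  change H2.orthogonalProjectionOnto (((ContinuousLinearMap.mul ℂ ℂ).holderL circleMeasure ∞ 2 2
    (boundary b)) (polyL2 (b.denom * x))) = _
  rw [h, ← coe_polyH2, Submodule.orthogonalProjectionOnto_mem_subspace_eq_self]

/-- The identity `|b|² + |A|² = 1` after clearing denominators. -/
theorem norm_sq_num_add {b A : RatFunc ℂ}
    (h : ∀ᵐ t ∂circleMeasure, ‖onCircle A t‖ ^ 2 + ‖onCircle b t‖ ^ 2 = 1) {z : ℂ}
    (hz : ‖z‖ = 1) :
    ‖(b.num * A.denom).eval z‖ ^ 2 + ‖(A.num * b.denom).eval z‖ ^ 2 =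
      ‖(b.denom * A.denom).eval z‖ ^ 2 := by
  obtain ⟨t, rfl⟩ := exists_toCircle_eq hz
  have hc : ∀ p : ℂ[X], Continuous
      fun t : UnitAddCircle => ‖p.eval (AddCircle.toCircle t : ℂ)‖ ^ 2 := fun p =>
    (polyCircle p).continuous.norm.pow 2
  -- Both sides are continuous and Haar measure charges every open set, so equality a.e. is equality
  -- everywhere, in particular at the zeros of `A`.
  refine congrFun ((Continuous.ae_eq_iff_eq circleMeasure ((hc _).add (hc _)) (hc _)).1 ?_) t
  filter_upwards [h, ae_eval_toCircle_ne_zero b.denom_ne_zero,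
    ae_eval_toCircle_ne_zero A.denom_ne_zero] with t h1 h2 h3
  rw [onCircle_eq, onCircle_eq, norm_div, norm_div, div_pow, div_pow] at h1
  have h2' : ‖b.denom.eval (AddCircle.toCircle t : ℂ)‖ ≠ 0 := norm_ne_zero_iff.2 h2
  have h3' : ‖A.denom.eval (AddCircle.toCircle t : ℂ)‖ ≠ 0 := norm_ne_zero_iff.2 h3
  field_simp at h1
  simp only [eval_mul, norm_mul, mul_pow, Pi.add_apply]
  linarith

/-! ### Functions represented by elements of `H²` -/

theorem norm_fourierCoeff_le (h : H2) (k : ℤ) : ‖fourierCoeff (h : L2) k‖ ≤ ‖h‖ := by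
  rw [fourierCoeff_eq_inner]
  refine (norm_inner_le_norm (𝕜 := ℂ) _ _).trans ?_
  rw [orthonormal_fourier.1 k, one_mul, Submodule.norm_coe]

theorem sum_norm_sq_fourierCoeff_le (h : H2) (s : Finset ℕ) :
    ∑ k ∈ s, ‖fourierCoeff (h : L2) k‖ ^ 2 ≤ ‖h‖ ^ 2 := by
  have ho : Orthonormal ℂ fun k : ℕ => fourierLp (T := 1) 2 (k : ℤ) :=
    orthonormal_fourier.comp _ Nat.cast_injective
  simpa only [fourierCoeff_eq_inner, Submodule.norm_coe] using
    ho.sum_inner_products_le (x := (h : L2)) (s := s)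

theorem mem_disc {z : ℂ} : z ∈ disc ↔ ‖z‖ < 1 := by simp [disc]

theorem isOpen_disc : IsOpen disc := Metric.isOpen_ball

theorem summable_fourierCoeff_mul_pow (h : H2) {z : ℂ} (hz : z ∈ disc) :
    Summable fun k : ℕ => fourierCoeff (h : L2) k * z ^ k := by
  refine Summable.of_norm_bounded (g := fun k => ‖h‖ * ‖z‖ ^ k)
    ((summable_geometric_of_lt_one (norm_nonneg z) (mem_disc.1 hz)).mul_left _) fun k => ?_
  rw [norm_mul, norm_pow]
  gcongr
  exact norm_fourierCoeff_le h k

theorem exists_represents (h : H2) : ∃ F, Represents F h :=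
  ⟨fun z => ∑' k : ℕ, fourierCoeff (h : L2) k * z ^ k, fun _ hz =>
    (summable_fourierCoeff_mul_pow h hz).hasSum⟩

theorem Represents.differentiableOn {F : ℂ → ℂ} {h : H2} (hF : Represents F h) :
    DifferentiableOn ℂ F disc := by
  intro z hz
  obtain ⟨r, hzr, hr⟩ := exists_between (mem_disc.1 hz)
  have hr0 : 0 ≤ r := (norm_nonneg z).trans hzr.le
  have hd : DifferentiableOn ℂ (fun w => ∑' k : ℕ, fourierCoeff (h : L2) k * w ^ k)
      (Metric.ball 0 r) := by
    refine Complex.differentiableOn_tsum_of_summable_norm (u := fun k => ‖h‖ * r ^ k)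
      ((summable_geometric_of_lt_one hr0 hr).mul_left _) (fun k => by fun_prop)
      Metric.isOpen_ball fun k w hw => ?_
    rw [norm_mul, norm_pow]
    gcongr
    · exact norm_fourierCoeff_le h k
    · exact (mem_ball_zero_iff.1 hw).le
  have hzb : z ∈ Metric.ball (0 : ℂ) r := mem_ball_zero_iff.2 hzr
  refine ((hd.congr fun w hw => ?_).differentiableAt
    (Metric.isOpen_ball.mem_nhds hzb)).differentiableWithinAt
  exact ((hF w (mem_disc.2 ((mem_ball_zero_iff.1 hw).trans hr))).tsum_eq).symm

/-- The growth of functions in the Hardy space. -/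
theorem Represents.norm_le {F : ℂ → ℂ} {h : H2} (hF : Represents F h) {z : ℂ} (hz : z ∈ disc) :
    ‖F z‖ ≤ (‖h‖ ^ 2 + 1) / √(1 - ‖z‖) := by
  have hz1 := mem_disc.1 hz
  have h0 : 0 < 1 - ‖z‖ := by linarith
  set s := √(1 - ‖z‖) with hs
  have hs0 : 0 < s := Real.sqrt_pos.2 h0
  have hss : s * s = 1 - ‖z‖ := Real.mul_self_sqrt h0.le
  refine le_of_tendsto (hF z hz).norm (Eventually.of_forall fun t => ?_)
  -- AM–GM weighted by s = √(1 - |z|), which balances ‖h‖²/s against s/(1 - |z|) = 1/s after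
  -- summation.
  have h1 : ∀ k ∈ t, ‖fourierCoeff (h : L2) k * z ^ k‖ ≤
      ‖fourierCoeff (h : L2) k‖ ^ 2 * (1 / s) + s * ‖z‖ ^ k := by
    intro k _
    rw [norm_mul, norm_pow]
    set a := ‖fourierCoeff (h : L2) k‖
    have hb0 : 0 ≤ ‖z‖ ^ k := by positivity
    have hb1 : ‖z‖ ^ k ≤ 1 := pow_le_one₀ (norm_nonneg z) hz1.le
    rw [mul_one_div, div_add' _ _ _ hs0.ne', le_div_iff₀ hs0]
    nlinarith [sq_nonneg (a - s * ‖z‖ ^ k), mul_nonneg hb0 (sub_nonneg.2 hb1), mul_pos hs0 hs0,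
      sq_nonneg a, mul_nonneg (mul_pos hs0 hs0).le (mul_nonneg hb0 (sub_nonneg.2 hb1)),
      mul_nonneg (mul_pos hs0 hs0).le hb0]
  have h2 : ∑ k ∈ t, ‖z‖ ^ k ≤ (1 - ‖z‖)⁻¹ :=
    ((summable_geometric_of_lt_one (norm_nonneg z) hz1).sum_le_tsum t
      fun k _ => by positivity).trans_eq (tsum_geometric_of_lt_one (norm_nonneg z) hz1)
  refine (norm_sum_le_of_le t h1).trans ?_
  rw [Finset.sum_add_distrib, ← Finset.sum_mul, ← Finset.mul_sum]
  calc _ ≤ ‖h‖ ^ 2 * (1 / s) + s * (1 - ‖z‖)⁻¹ := by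
        gcongr
        exact sum_norm_sq_fourierCoeff_le h t
    _ = (‖h‖ ^ 2 + 1) / s := by
        rw [← hss]
        field_simp

/-- In a Stolz region |z - ζ| is at most M (1 - |z|), which beats the growth (1 - |z|)^(-1/2) of G.
-/
theorem tendsto_sub_mul_stolz {G : ℂ → ℂ} (hG : MemH2 G) (ζ : ℂ) (M : ℝ) (hζ : ‖ζ‖ = 1) :
    Tendsto (fun z => (z - ζ) * G z) (𝓝[stolz ζ M] ζ) (𝓝 0) := by
  obtain ⟨h, hh⟩ := hG
  have hb : Tendsto (fun z : ℂ => M * (‖h‖ ^ 2 + 1) * √(1 - ‖z‖)) (𝓝[stolz ζ M] ζ) (𝓝 0) := by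
    have : ContinuousAt (fun z : ℂ => M * (‖h‖ ^ 2 + 1) * √(1 - ‖z‖)) ζ := by fun_prop
    have h1 := this.tendsto.mono_left (nhdsWithin_le_nhds (s := stolz ζ M))
    simpa [hζ] using h1
  refine squeeze_zero_norm' ?_ hb
  filter_upwards [self_mem_nhdsWithin] with z hz
  have h0 : 0 < 1 - ‖z‖ := by linarith [mem_disc.1 hz.1]
  have hs0 : 0 < √(1 - ‖z‖) := Real.sqrt_pos.2 h0
  rw [norm_mul]
  calc ‖z - ζ‖ * ‖G z‖ ≤ M * (1 - ‖z‖) * ((‖h‖ ^ 2 + 1) / √(1 - ‖z‖)) :=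
        mul_le_mul hz.2.le (hh.norm_le hz.1) (norm_nonneg _) ((norm_nonneg _).trans hz.2.le)
    _ = M * (‖h‖ ^ 2 + 1) * ((1 - ‖z‖) / √(1 - ‖z‖)) := by ring
    _ = _ := by rw [Real.div_sqrt]

/-! ### Backward shifts and polynomial multiples of power series -/

theorem hasSum_coeff_mul {c : ℕ → ℂ} {z S : ℂ} (h : HasSum (fun k => c k * z ^ k) S) (p : ℂ[X]) :
    HasSum (fun k => PowerSeries.coeff k ((p : PowerSeries ℂ) * PowerSeries.mk c) * z ^ k)
      (p.eval z * S) := by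
  induction p using Polynomial.induction_on' with
  | add p q hp hq =>
    simp only [Polynomial.coe_add, add_mul, map_add, eval_add]
    exact hp.add hq
  | monomial n a =>
    have h1 : ∀ k, PowerSeries.coeff k (((monomial n a : ℂ[X]) : PowerSeries ℂ) *
        PowerSeries.mk c) = if n ≤ k then a * c (k - n) else 0 := by
      intro k
      rw [← C_mul_X_pow_eq_monomial, Polynomial.coe_mul, Polynomial.coe_C, Polynomial.coe_pow,
        Polynomial.coe_X, mul_assoc, PowerSeries.coeff_C_mul, PowerSeries.coeff_X_pow_mul']
      simp
    simp only [h1]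
    rw [← (add_left_injective n).hasSum_iff, eval_monomial]
    · have h2 := h.mul_left (a * z ^ n)
      have h3 : ((fun k => (if n ≤ k then a * c (k - n) else 0) * z ^ k) ∘ fun k => k + n) =
          fun k => a * z ^ n * (c k * z ^ k) := by
        funext k
        simp only [Function.comp_apply, if_pos (Nat.le_add_left n k), Nat.add_sub_cancel, pow_add]
        ring
      rw [h3]
      convert h2 using 1
    · intro k hk
      have : ¬ n ≤ k := fun hle => hk ⟨k - n, Nat.sub_add_cancel hle⟩
      simp [this]

/-- Reversing coefficients turns convolution into correlation, which is how the adjoint of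
multiplication by a polynomial acts on coefficients. -/
theorem coeff_reflect_mul {P : ℂ[X]} {N : ℕ} (hN : P.natDegree ≤ N) (k : ℕ) (c : ℕ → ℂ) :
    PowerSeries.coeff (N + k) ((reflect N P : PowerSeries ℂ) * PowerSeries.mk c) =
      ∑ j ∈ Finset.range (N + 1), P.coeff j * c (k + j) := by
  rw [PowerSeries.coeff_mul, Finset.Nat.sum_antidiagonal_eq_sum_range_succ_mk,
    show (N + k).succ = (N + 1) + k by omega, Finset.sum_range_add]
  have h0 : ∀ x ∈ Finset.range k, PowerSeries.coeff (N + 1 + x) (reflect N P : PowerSeries ℂ) *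
      PowerSeries.coeff (N + k - (N + 1 + x)) (PowerSeries.mk c) = 0 := by
    intro x _
    rw [Polynomial.coeff_coe, coeff_reflect, revAt_eq_self_of_lt (by omega),
      coeff_eq_zero_of_natDegree_lt (by omega), zero_mul]
  rw [Finset.sum_eq_zero h0, add_zero, ← Finset.sum_flip]
  refine Finset.sum_congr rfl fun j hj => ?_
  have hj' : j ≤ N := by simpa [Nat.lt_succ_iff] using hj
  rw [Polynomial.coeff_coe, coeff_reflect, revAt_le (by omega), PowerSeries.coeff_mk]
  congr 2 <;> omega

/-- On the circle the conjugate of P is z^(-N) P♯, so testing f against P z^k picks out the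
coefficient of index N + k in P♯ F. -/
theorem inner_polyH2_mul_X_pow {P : ℂ[X]} {N : ℕ} (hN : P.natDegree ≤ N) (k : ℕ) (f : H2) :
    inner ℂ (polyH2 (P * X ^ k)) f =
      PowerSeries.coeff (N + k) ((reflect N (P.map (starRingEnd ℂ)) : PowerSeries ℂ) *
        PowerSeries.mk fun j : ℕ => fourierCoeff (f : L2) j) := by
  rw [coeff_reflect_mul (natDegree_map_le.trans hN), inner_polyH2 (n := k + (N + 1)) _ _
    (by have := natDegree_mul_le (p := P) (q := X ^ k); rw [natDegree_X_pow] at this; omega),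
    Finset.sum_range_add, Finset.sum_eq_zero, zero_add]
  · refine Finset.sum_congr rfl fun j _ => ?_
    rw [coeff_mul_X_pow', if_pos (by omega), coeff_map]
    congr 3
    omega
  · intro j hj
    rw [coeff_mul_X_pow', if_neg (by simpa using hj), map_zero, zero_mul]

/-- If `P^* f = Q^* g`, then the reflected polynomials satisfy `P♯ F - Q♯ G ∈ ℂ[X]`. -/
theorem exists_polynomial_of_inner_eq {P Q : ℂ[X]} {N : ℕ} (hP : P.natDegree ≤ N)
    (hQ : Q.natDegree ≤ N) {f g : H2} {F G : ℂ → ℂ} (hF : Represents F f) (hG : Represents G g)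
    (h : ∀ x, inner ℂ (polyH2 (Q * x)) g = inner ℂ (polyH2 (P * x)) f) :
    ∃ s : ℂ[X], ∀ z ∈ disc, (reflect N (P.map (starRingEnd ℂ))).eval z * F z =
      (reflect N (Q.map (starRingEnd ℂ))).eval z * G z + s.eval z := by
  set D : PowerSeries ℂ := (reflect N (P.map (starRingEnd ℂ)) : PowerSeries ℂ) *
        PowerSeries.mk (fun j : ℕ => fourierCoeff (f : L2) j) -
      (reflect N (Q.map (starRingEnd ℂ)) : PowerSeries ℂ) *
        PowerSeries.mk (fun j : ℕ => fourierCoeff (g : L2) j) with hD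
  -- Testing with x = X^k kills every coefficient of index at least N, so the difference is its own
  -- truncation.
  have hD0 : ∀ k, N ≤ k → PowerSeries.coeff k D = 0 := by
    intro k hk
    obtain ⟨k, rfl⟩ := Nat.exists_eq_add_of_le hk
    rw [hD, map_sub, ← inner_polyH2_mul_X_pow hP, ← inner_polyH2_mul_X_pow hQ, h, sub_self]
  refine ⟨D.trunc N, fun z hz => ?_⟩
  have h1 := (hasSum_coeff_mul (hF z hz) (reflect N (P.map (starRingEnd ℂ)))).sub
    (hasSum_coeff_mul (hG z hz) (reflect N (Q.map (starRingEnd ℂ))))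
  simp only [← sub_mul, ← map_sub] at h1
  have h2 := h1.unique (hasSum_sum_of_ne_finset_zero (s := Finset.range N) fun k hk => by
    rw [hD0 k (by simpa using hk), zero_mul])
  rw [← sub_eq_iff_eq_add', h2, ← eval₂_id (R := ℂ), PowerSeries.eval₂_trunc_eq_sum_range]
  rfl

/-! ### Zeros of reflected polynomials on the circle -/

/-- Reflection is multiplicative once N is split as a sum of degree bounds, and it sends X - c to 1
- c X. -/
theorem pow_dvd_reflect {c : ℂ} {m N : ℕ} {Q : ℂ[X]} (hQ : Q.natDegree ≤ N)
    (h : (X - C c) ^ m ∣ Q) : (1 - C c * X) ^ m ∣ reflect N Q := by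
  obtain rfl | hQ0 := eq_or_ne Q 0
  · simp
  obtain ⟨R, rfl⟩ := h
  have hm : natDegree ((X - C c) ^ m) = m := by rw [natDegree_pow, natDegree_X_sub_C, mul_one]
  rw [natDegree_mul (left_ne_zero_of_mul hQ0) (right_ne_zero_of_mul hQ0), hm] at hQ
  obtain ⟨k, rfl⟩ := Nat.exists_eq_add_of_le (le_of_add_le_left hQ)
  rw [reflect_mul _ _ hm.le (by omega)]
  refine Dvd.dvd.mul_right (dvd_of_eq ?_) _
  clear hQ hm hQ0
  induction m with
  | zero => simp
  | succ m ih =>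
    rw [pow_succ, pow_succ, reflect_mul _ _ (by rw [natDegree_pow, natDegree_X_sub_C, mul_one])
      (natDegree_X_sub_C_le c), ← ih]
    congr 1
    rw [reflect_sub, reflect_C, ← pow_one (X : ℂ[X]), reflect_monomial]
    simp [revAt_le]

/-- Zeros move by z ↦ 1/conj z, which fixes the circle: 1 - conj ζ · X = -conj ζ · (X - ζ). -/
theorem pow_dvd_reflect_map_conj {ζ : ℂ} (hζ : ‖ζ‖ = 1) {m N : ℕ} {Q : ℂ[X]}
    (hQ : Q.natDegree ≤ N) (h : (X - C ζ) ^ m ∣ Q) :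
    (X - C ζ) ^ m ∣ reflect N (Q.map (starRingEnd ℂ)) := by
  have h1 := map_dvd (mapRingHom (starRingEnd ℂ)) h
  simp only [coe_mapRingHom, Polynomial.map_pow, Polynomial.map_sub, map_X, map_C] at h1
  refine (pow_dvd_pow_of_dvd ⟨C (-starRingEnd ℂ ζ), ?_⟩ m).trans
    (pow_dvd_reflect (natDegree_map_le.trans hQ) h1)
  have hc : ζ * starRingEnd ℂ ζ = 1 := by
    rw [Complex.mul_conj, Complex.normSq_eq_norm_sq, hζ]; simp
  rw [sub_mul, ← C_mul, mul_neg, hc, C_neg, C_neg, C_1]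
  ring

/-- For |ζ| = 1, P♯(ζ) = ζ^N · conj P(ζ). -/
theorem eval_reflect_map_conj_ne_zero {ζ : ℂ} (hζ : ‖ζ‖ = 1) {N : ℕ} {P : ℂ[X]}
    (hP : P.natDegree ≤ N) (h : P.eval ζ ≠ 0) :
    (reflect N (P.map (starRingEnd ℂ))).eval ζ ≠ 0 := by
  have hc : starRingEnd ℂ ζ * ζ = 1 := by
    rw [mul_comm, Complex.mul_conj, Complex.normSq_eq_norm_sq, hζ]; simp
  let _ : Invertible (starRingEnd ℂ ζ) := ⟨ζ, by rwa [mul_comm], hc⟩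
  have h1 := eval₂_reflect_mul_pow (RingHom.id ℂ) (starRingEnd ℂ ζ) N (P.map (starRingEnd ℂ))
    (natDegree_map_le.trans hP)
  intro h0
  rw [show ⅟(starRingEnd ℂ ζ) = ζ from rfl, eval₂_id, h0, zero_mul, eval₂_id, eval_map,
    eval₂_at_apply] at h1
  exact h (by simpa using h1.symm)

/-! ### Local expansions of functions in `ℋ(b)` -/

/-- Every Stolz region contains the radius ending at ζ; this gives uniqueness of limits along it. -/
theorem stolz_neBot {ζ : ℂ} (hζ : ‖ζ‖ = 1) {M : ℝ} (hM : 1 < M) : (𝓝[stolz ζ M] ζ).NeBot := by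
  refine mem_closure_iff_nhdsWithin_neBot.1
    (mem_closure_of_tendsto (f := fun r : ℝ => (r : ℂ) * ζ) (b := 𝓝[<] (1 : ℝ)) ?_ ?_)
  · have : ContinuousAt (fun r : ℝ => (r : ℂ) * ζ) 1 := by fun_prop
    simpa using this.tendsto.mono_left nhdsWithin_le_nhds
  · filter_upwards [Ioo_mem_nhdsLT (zero_lt_one' ℝ)] with r hr
    have h1 : ‖(r : ℂ) * ζ‖ = r := by simp [hζ, abs_of_pos hr.1]
    have h2 : ‖(r : ℂ) * ζ - ζ‖ = 1 - r := by
      rw [← sub_one_mul, norm_mul, hζ, mul_one, ← Complex.ofReal_one, ← Complex.ofReal_sub,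
        Complex.norm_real, Real.norm_eq_abs, abs_sub_comm, abs_of_pos (by linarith [hr.2])]
    refine ⟨mem_disc.2 (h1.trans_lt hr.2), ?_⟩
    rw [h1, h2]
    nlinarith [hr.2]

theorem tendsto_eval_stolz (p : ℂ[X]) (ζ : ℂ) (M : ℝ) :
    Tendsto (fun z => p.eval z) (𝓝[stolz ζ M] ζ) (𝓝 (p.eval ζ)) :=
  p.continuous.continuousAt.tendsto.mono_left nhdsWithin_le_nhds

theorem tendsto_sub_stolz (ζ : ℂ) (M : ℝ) :
    Tendsto (fun z => z - ζ) (𝓝[stolz ζ M] ζ) (𝓝 0) := by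
  have : ContinuousAt (fun z : ℂ => z - ζ) ζ := by fun_prop
  simpa using this.tendsto.mono_left (nhdsWithin_le_nhds (s := stolz ζ M))

theorem sub_ne_zero_of_mem_disc {ζ z : ℂ} (hζ : ‖ζ‖ = 1) (hz : z ∈ disc) : z - ζ ≠ 0 := by
  intro h
  rw [sub_eq_zero] at h
  rw [h, mem_disc, hζ] at hz
  exact lt_irrefl _ hz

theorem mem_circleZeros {A : RatFunc ℂ} {ζ : ℂ} (h : ζ ∈ circleZeros A) :
    A.num ≠ 0 ∧ A.num.eval ζ = 0 ∧ ‖ζ‖ = 1 := by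
  classical
  simp only [circleZeros, Finset.mem_filter, Multiset.mem_toFinset] at h
  exact ⟨ne_zero_of_mem_roots h.1, isRoot_of_mem_roots h.1, h.2⟩

theorem eval_denom_ne_zero_of_eval_num {R : RatFunc ℂ} {ζ : ℂ} (h : R.num.eval ζ = 0) :
    R.denom.eval ζ ≠ 0 := by
  intro h'
  obtain ⟨u, v, huv⟩ := RatFunc.isCoprime_num_denom R
  simpa [h, h'] using congrArg (eval ζ) huv

/-- Here R = P♯ and (z - ζ)^m V = Q♯ for P = `b.num * A.denom` and Q = `A.num * b.denom`, reflected
at the larger of the two degrees. -/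
theorem MemHb.exists_eq {b A : RatFunc ℂ} (hb : IsSymbol b)
    (hA : ∀ᵐ t ∂circleMeasure, ‖onCircle A t‖ ^ 2 + ‖onCircle b t‖ ^ 2 = 1) {F : ℂ → ℂ}
    (hF : MemHb b F) {ζ : ℂ} (hζ : ζ ∈ circleZeros A) :
    ∃ (R V s : ℂ[X]) (G : ℂ → ℂ), MemH2 G ∧ R.eval ζ ≠ 0 ∧
      ∀ z ∈ disc, R.eval z * F z = (z - ζ) ^ mult A ζ * V.eval z * G z + s.eval z := by
  obtain ⟨hnum, hroot, hnorm⟩ := mem_circleZeros hζ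
  obtain ⟨f, hf, hFf⟩ := hF
  have hT : ‖toeplitz (boundary b)‖ ≤ 1 := (norm_toeplitz_le _).trans (norm_boundary_le hb)
  obtain ⟨g, hg⟩ := exists_inner_mul_eq (P := b.num * A.denom) (Q := A.num * b.denom)
    (d := b.denom * A.denom) hT (fun x => by
      rw [mul_assoc, mul_assoc, toeplitz_polyH2 hb]) (fun z hz => norm_sq_num_add hA hz) hf
  obtain ⟨G, hG⟩ := exists_represents g
  obtain ⟨s, hs⟩ := exists_polynomial_of_inner_eq (le_max_left _ _) (le_max_right _ _) hFf hG hg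
  have hdvd : (X - C ζ) ^ mult A ζ ∣ A.num * b.denom :=
    (pow_rootMultiplicity_dvd A.num ζ).mul_right _
  obtain ⟨V, hV⟩ := pow_dvd_reflect_map_conj hnorm
    (le_max_right (b.num * A.denom).natDegree (A.num * b.denom).natDegree) hdvd
  refine ⟨_, V, s, G, ⟨g, hG⟩, eval_reflect_map_conj_ne_zero hnorm
    (le_max_left (b.num * A.denom).natDegree (A.num * b.denom).natDegree) ?_, fun z hz => ?_⟩
  -- At ζ the Pythagorean identity reduces to |b| = 1 with denominators cleared; a zero of `b.num`
  -- there would be one of `b.denom` too, against coprimality.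
  · have hden := eval_denom_ne_zero_of_eval_num hroot
    have h1 := norm_sq_num_add hA hnorm
    simp only [eval_mul, hroot, zero_mul, norm_zero, norm_mul, mul_pow] at h1
    rw [eval_mul]
    refine mul_ne_zero (fun h0 => eval_denom_ne_zero_of_eval_num h0 ?_) hden
    simpa [h0, hden] using h1
  · rw [hs z hz, hV]
    simp

/-- Near a zero `ζ` of `A` of order `m`, functions in `ℋ(b)` agree with a polynomial up to an error
`o(|z - ζ| ^ (m - 1))` non-tangentially. -/
theorem MemHb.exists_isLittleO {b A : RatFunc ℂ} (hb : IsSymbol b)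
    (hA : ∀ᵐ t ∂circleMeasure, ‖onCircle A t‖ ^ 2 + ‖onCircle b t‖ ^ 2 = 1) {F : ℂ → ℂ}
    (hF : MemHb b F) {ζ : ℂ} (hζ : ζ ∈ circleZeros A) {n : ℕ} (hn : mult A ζ = n + 1) :
    ∃ p : ℂ[X], ∀ M : ℝ,
      (fun z => F z - p.eval z) =o[𝓝[stolz ζ M] ζ] fun z => (z - ζ) ^ n := by
  obtain ⟨R, V, s, G, hG, hR, h⟩ := hF.exists_eq hb hA hζ
  have hnorm := (mem_circleZeros hζ).2.2
  have hcop : IsCoprime R ((X - C ζ) ^ (n + 1)) :=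
    (((irreducible_X_sub_C ζ).coprime_iff_not_dvd).2 (by rwa [dvd_iff_isRoot])).symm.pow_right
  -- From c R + e (z - ζ)^(n+1) = 1 one gets s/R = s c + (z - ζ)^(n+1) s e / R, so s c replaces a
  -- Taylor polynomial of s/R.
  obtain ⟨c, e, hce⟩ := hcop
  refine ⟨s * c, fun M => ?_⟩
  rw [Asymptotics.isLittleO_iff_exists_eq_mul]
  refine ⟨fun z => (V.eval z * ((z - ζ) * G z) + (z - ζ) * (s * e).eval z) / R.eval z, ?_, ?_⟩
  · have h1 := (((tendsto_eval_stolz V ζ M).mul (tendsto_sub_mul_stolz hG ζ M hnorm)).add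
      ((tendsto_sub_stolz ζ M).mul (tendsto_eval_stolz (s * e) ζ M))).div
      (tendsto_eval_stolz R ζ M) hR
    rwa [mul_zero, zero_mul, add_zero, zero_div] at h1
  · filter_upwards [self_mem_nhdsWithin, (tendsto_eval_stolz R ζ M).eventually_ne hR] with z hz hRz
    have h1 := h z hz.1
    have h2 := congrArg (eval z) hce
    simp only [eval_add, eval_mul, eval_pow, eval_sub, eval_X, eval_C, eval_one] at h2
    simp only [Pi.mul_apply, eval_mul]
    rw [div_mul_eq_mul_div, eq_div_iff hRz]
    rw [hn] at h1
    linear_combination h1 - s.eval z * h2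

/-- Provides the discs for the Cauchy estimates. The aperture is (M + 1/2)/(1/2), since |w - ζ| < (M
+ 1/2)(1 - |z|) and 1 - |w| ≥ (1 - |z|)/2. -/
theorem mem_stolz_of_mem_closedBall {ζ z w : ℂ} {M : ℝ} (hM : 1 < M) (hz : z ∈ stolz ζ M)
    (hw : w ∈ Metric.closedBall z ((1 - ‖z‖) / 2)) : w ∈ stolz ζ (2 * M + 1) := by
  have h1 : ‖w - z‖ ≤ (1 - ‖z‖) / 2 := mem_closedBall_iff_norm.1 hw
  have h2 : ‖w‖ ≤ ‖z‖ + ‖w - z‖ := by simpa using norm_add_le z (w - z)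
  have h3 : ‖w - ζ‖ ≤ ‖w - z‖ + ‖z - ζ‖ := by simpa using norm_add_le (w - z) (z - ζ)
  have h4 := mem_disc.1 hz.1
  have h5 := hz.2
  refine ⟨mem_disc.2 (by linarith), ?_⟩
  nlinarith

theorem iteratedDeriv_eval (p : ℂ[X]) (l : ℕ) :
    iteratedDeriv l (fun z => p.eval z) = fun z => (derivative^[l] p).eval z := by
  induction l with
  | zero => simp
  | succ l ih =>
    rw [iteratedDeriv_succ, ih, Function.iterate_succ_apply']
    funext z
    exact Polynomial.deriv _

/-- Non-tangential polynomial approximations can be differentiated, by the Cauchy estimates. -/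
theorem hasNTLimit_iteratedDeriv_of_isLittleO {F : ℂ → ℂ} (hF : DifferentiableOn ℂ F disc) {ζ : ℂ}
    (hζ : ‖ζ‖ = 1) {n : ℕ} {p : ℂ[X]}
    (h : ∀ M : ℝ, (fun z => F z - p.eval z) =o[𝓝[stolz ζ M] ζ] fun z => (z - ζ) ^ n)
    {l : ℕ} (hl : l ≤ n) : HasNTLimit (iteratedDeriv l F) ζ ((derivative^[l] p).eval ζ) := by
  intro M hM
  have key : Tendsto (fun z => iteratedDeriv l (fun z => F z - p.eval z) z) (𝓝[stolz ζ M] ζ)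
      (𝓝 0) := by
    rw [Metric.tendsto_nhdsWithin_nhds]
    intro ε hε
    -- The Cauchy constant: 2^n from |w - ζ| ≤ 2 |z - ζ| on the circle, (2M)^l from its radius (1 -
    -- |z|)/2 ≥ |z - ζ|/(2M).
    set K : ℝ := l.factorial * (2 ^ n * (2 * M) ^ l) with hK
    have hK0 : 0 < K := by positivity
    obtain ⟨δ, hδ, hb⟩ := Metric.eventually_nhds_iff.1 (eventually_nhdsWithin_iff.1
      ((h (2 * M + 1)).def (c := ε / (2 * K)) (by positivity)))
    refine ⟨min (δ / 2) 1, by positivity, fun z hz hzd => ?_⟩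
    rw [dist_eq_norm] at hzd
    have hzδ : ‖z - ζ‖ < δ / 2 := hzd.trans_le (min_le_left _ _)
    have hz1 : ‖z - ζ‖ ≤ 1 := hzd.le.trans (min_le_right _ _)
    have h0 : 0 < 1 - ‖z‖ := by linarith [mem_disc.1 hz.1]
    have h2 : 1 - ‖z‖ ≤ ‖z - ζ‖ := by
      have := norm_sub_norm_le ζ z
      rwa [hζ, norm_sub_rev] at this
    have hpos : 0 < ‖z - ζ‖ := h0.trans_le h2
    have hmem : Metric.closedBall z ((1 - ‖z‖) / 2) ⊆ stolz ζ (2 * M + 1) := fun w hw =>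
      mem_stolz_of_mem_closedBall hM hz hw
    have hC : ∀ w ∈ Metric.sphere z ((1 - ‖z‖) / 2),
        ‖F w - p.eval w‖ ≤ ε / (2 * K) * (2 * ‖z - ζ‖) ^ n := by
      intro w hw
      have hw' := Metric.sphere_subset_closedBall hw
      have h1 : ‖w - z‖ ≤ (1 - ‖z‖) / 2 := mem_closedBall_iff_norm.1 hw'
      have h3 : ‖w - ζ‖ ≤ ‖w - z‖ + ‖z - ζ‖ := by simpa using norm_add_le (w - z) (z - ζ)
      refine (hb (by rw [dist_eq_norm]; linarith) (hmem hw')).trans ?_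
      rw [norm_pow]
      gcongr
      linarith
    have hd : DiffContOnCl ℂ (fun z => F z - p.eval z) (Metric.ball z ((1 - ‖z‖) / 2)) := by
      refine DifferentiableOn.diffContOnCl ?_
      rw [closure_ball _ (by positivity)]
      exact (hF.mono fun w hw => (hmem hw).1).sub p.differentiable.differentiableOn
    rw [dist_zero_right]
    refine (Complex.norm_iteratedDeriv_le_of_forall_mem_sphere_norm_le l (by positivity) hd
      hC).trans_lt ?_
    have hρ : (‖z - ζ‖ / (2 * M)) ^ l ≤ ((1 - ‖z‖) / 2) ^ l := by
      gcongr ?_ ^ l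
      rw [div_le_iff₀ (by positivity)]
      linarith [hz.2]
    obtain ⟨k, rfl⟩ := Nat.exists_eq_add_of_le hl
    calc _ ≤ l.factorial * (ε / (2 * K) * (2 * ‖z - ζ‖) ^ (l + k)) / (‖z - ζ‖ / (2 * M)) ^ l := by
          gcongr
      _ = ε / 2 * ‖z - ζ‖ ^ k := by
          rw [hK, div_pow, mul_pow 2 ‖z - ζ‖, pow_add ‖z - ζ‖]
          field_simp
      _ ≤ ε / 2 * 1 := by
          gcongr
          exact pow_le_one₀ (norm_nonneg _) hz1
      _ < ε := by linarith
  have h1 := key.add (tendsto_eval_stolz (derivative^[l] p) ζ M)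
  rw [zero_add] at h1
  refine h1.congr' ?_
  filter_upwards [self_mem_nhdsWithin] with z hz
  have hFz : ContDiffAt ℂ l F z :=
    ((hF.analyticOnNhd isOpen_disc) z hz.1).contDiffAt
  have hpz : ContDiffAt ℂ l (fun z => p.eval z) z := by
    simpa [aeval_def, eval₂_id] using (p.contDiff_aeval (𝕜 := ℂ) l).contDiffAt (x := z)
  have h2 : iteratedDeriv l (fun z => F z - p.eval z) z =
      iteratedDeriv l F z - iteratedDeriv l (fun z => p.eval z) z := iteratedDeriv_sub hFz hpz
  rw [h2, iteratedDeriv_eval]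
  ring

/-- The leading non-tangential behaviour read off from a polynomial approximation. -/
theorem tendsto_div_pow_of_isLittleO {F : ℂ → ℂ} {ζ : ℂ} (hζ : ‖ζ‖ = 1) {n k : ℕ} (hk : k ≤ n)
    {p : ℂ[X]} {M : ℝ}
    (h : (fun z => F z - ((X - C ζ) ^ k * p).eval z) =o[𝓝[stolz ζ M] ζ] fun z => (z - ζ) ^ n) :
    Tendsto (fun z => F z / (z - ζ) ^ k) (𝓝[stolz ζ M] ζ) (𝓝 (p.eval ζ)) := by
  obtain ⟨ψ, hψ, he⟩ := Asymptotics.isLittleO_iff_exists_eq_mul.1 h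
  have h1 := (hψ.mul (((tendsto_sub_stolz ζ M).pow (n - k)))).add (tendsto_eval_stolz p ζ M)
  rw [zero_mul, zero_add] at h1
  refine h1.congr' ?_
  filter_upwards [self_mem_nhdsWithin, he] with z hz hez
  have h0 : (z - ζ) ^ k ≠ 0 := pow_ne_zero _ (sub_ne_zero_of_mem_disc hζ hz.1)
  simp only [eval_mul, eval_pow, eval_sub, eval_X, eval_C, Pi.mul_apply] at hez
  rw [eq_div_iff h0]
  have : (z - ζ) ^ n = (z - ζ) ^ (n - k) * (z - ζ) ^ k := by
    rw [← pow_add, Nat.sub_add_cancel hk]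
  rw [this] at hez
  linear_combination -hez

/-! ### Non-tangential limits of the symbol -/

/-- Here u has exact order k at ζ, and |u φ| ≤ |u| forces q to vanish there to order at least k; φ =
(u φ)/u then tends to the quotient of the coefficients of (z - ζ)^k. -/
theorem exists_hasNTLimit {u φ : ℂ → ℂ} (hφ : Set.MapsTo φ disc disc) {ζ : ℂ} (hζ : ‖ζ‖ = 1)
    {n k : ℕ} (hk : k ≤ n) {p q : ℂ[X]} (hp : p.eval ζ ≠ 0)
    (hu : ∀ M : ℝ, (fun z => u z - ((X - C ζ) ^ k * p).eval z) =o[𝓝[stolz ζ M] ζ]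
      fun z => (z - ζ) ^ n)
    (huφ : ∀ M : ℝ, (fun z => u z * φ z - q.eval z) =o[𝓝[stolz ζ M] ζ] fun z => (z - ζ) ^ n) :
    ∃ L, HasNTLimit φ ζ L ∧ ‖L‖ ≤ 1 := by
  have hle : ∀ z ∈ disc, ∀ v : ℂ, ‖u z * φ z / v‖ ≤ ‖u z / v‖ := by
    intro z hz v
    rw [mul_div_right_comm, norm_mul]
    exact mul_le_of_le_one_right (norm_nonneg _) (mem_disc.1 (hφ hz)).le
  have hdvd : ∀ j ≤ k, (X - C ζ) ^ j ∣ q := by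
    intro j
    induction j with
    | zero => simp
    | succ j ih =>
      intro hj
      obtain ⟨q', rfl⟩ := ih (by omega)
      have := stolz_neBot hζ (one_lt_two (α := ℝ))
      have h1 := tendsto_div_pow_of_isLittleO hζ (by omega) (huφ 2)
      have h2 : Tendsto (fun z => u z / (z - ζ) ^ j) (𝓝[stolz ζ 2] ζ)
          (𝓝 (((X - C ζ) ^ (k - j) * p).eval ζ)) := by
        refine tendsto_div_pow_of_isLittleO hζ (n := n) (by omega) ?_
        rw [← mul_assoc, ← pow_add, Nat.add_sub_cancel' (by omega)]
        exact hu 2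
      have h3 : ((X - C ζ) ^ (k - j) * p).eval ζ = 0 := by
        simp [show k - j ≠ 0 by omega]
      rw [h3] at h2
      have h4 : q'.eval ζ = 0 := by
        refine tendsto_nhds_unique h1 (squeeze_zero_norm' (a := fun z =>
          ‖u z / (z - ζ) ^ j‖) ?_ (tendsto_zero_iff_norm_tendsto_zero.1 h2))
        filter_upwards [self_mem_nhdsWithin] with z hz using hle z hz.1 _
      rw [pow_succ]
      exact mul_dvd_mul_left _ (dvd_iff_isRoot.2 h4)
  obtain ⟨q', rfl⟩ := hdvd k le_rfl
  have hlim : HasNTLimit φ ζ (q'.eval ζ / p.eval ζ) := by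
    intro M hM
    have h1 := tendsto_div_pow_of_isLittleO hζ hk (hu M)
    have h2 := tendsto_div_pow_of_isLittleO hζ hk (huφ M)
    refine (h2.div h1 hp).congr' ?_
    filter_upwards [h1.eventually_ne hp] with z hz
    have ha : u z ≠ 0 := fun h => hz (by rw [h, zero_div])
    have hb : (z - ζ) ^ k ≠ 0 := fun h => hz (by rw [h, div_zero])
    simp only [Pi.div_apply]
    field_simp
  refine ⟨_, hlim, ?_⟩
  have := stolz_neBot hζ (one_lt_two (α := ℝ))
  refine le_of_tendsto (hlim 2 one_lt_two).norm ?_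
  filter_upwards [self_mem_nhdsWithin] with z hz using (mem_disc.1 (hφ hz.1)).le

theorem eval_aPoly_ne_zero (A : RatFunc ℂ) {z : ℂ} (hz : z ∈ disc) : (aPoly A).eval z ≠ 0 := by
  rw [aPoly, eval_prod]
  refine Finset.prod_ne_zero_iff.2 fun ζ hζ => ?_
  simpa using fun h => absurd h (sub_ne_zero_of_mem_disc (mem_circleZeros hζ).2.2 hz)

/-- If the weight belongs to `H²`, then a unimodular limit of `φ` at a zero of `a` at which `u` does
not vanish to full order is a zero of `a`. -/
theorem eval_aPoly_eq_zero_of_memH2 {A : RatFunc ℂ} {u φ : ℂ → ℂ} (hw : MemH2 (weight A u φ))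
    {ζ : ℂ} (hζ : ζ ∈ circleZeros A) {n k : ℕ} (hn : mult A ζ = n + 1) (hk : k ≤ n) {c L : ℂ}
    (hc : c ≠ 0) (hu : Tendsto (fun z => u z / (z - ζ) ^ k) (𝓝[stolz ζ 2] ζ) (𝓝 c))
    (hL : HasNTLimit φ ζ L) (hL1 : 1 ≤ ‖L‖) : (aPoly A).eval L = 0 := by
  have hnorm := (mem_circleZeros hζ).2.2
  have := stolz_neBot hnorm (one_lt_two (α := ℝ))
  obtain ⟨a₁, ha₁⟩ : (X - C ζ) ^ mult A ζ ∣ aPoly A := Finset.dvd_prod_of_mem _ hζ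
  have hφ := hL 2 one_lt_two
  -- Two computations of the limit of w a/(z - ζ)^k: from the definition of w it is c · a(L) · ∏ (L
  -- - φ(ξ))^(m_ξ); from a = (z - ζ)^(n+1) a₁ and (z - ζ) w → 0 it is 0.
  have h1 := (hu.mul (((aPoly A).continuous.tendsto L).comp hφ)).mul
    (tendsto_finsetProd (interiorZeros A u φ) fun ξ _ =>
      (hφ.sub_const (ntLimit φ ξ)).pow (mult A ξ))
  have h2 : Tendsto (fun z => (z - ζ) ^ (n - k) * ((z - ζ) * weight A u φ z) * a₁.eval z)
      (𝓝[stolz ζ 2] ζ) (𝓝 0) := by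
    have h := (((tendsto_sub_stolz ζ 2).pow (n - k)).mul
      (tendsto_sub_mul_stolz hw ζ 2 hnorm)).mul (tendsto_eval_stolz a₁ ζ 2)
    simpa using h
  have h3 := tendsto_nhds_unique h1 (h2.congr' ?_)
  -- Each φ(ξ) lies in the open disc while |L| ≥ 1, so no factor vanishes.
  · have hprod : ∏ ξ ∈ interiorZeros A u φ, (L - ntLimit φ ξ) ^ mult A ξ ≠ 0 := by
      refine Finset.prod_ne_zero_iff.2 fun ξ hξ => pow_ne_zero _ fun h0 => ?_
      classical
      simp only [interiorZeros, Finset.mem_filter] at hξ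
      obtain ⟨hξ, -, L', hL', hlim⟩ := hξ
      rw [hlim.ntLimit_eq (mem_circleZeros hξ).2.2, sub_eq_zero] at h0
      rw [h0] at hL1
      exact absurd (mem_disc.1 hL') (not_lt.2 hL1)
    simpa [hc, hprod] using h3
  · filter_upwards [self_mem_nhdsWithin] with z hz
    have hz0 := sub_ne_zero_of_mem_disc hnorm hz.1
    have ha := eval_aPoly_ne_zero A hz.1
    have hpow : (z - ζ) ^ (n + 1) = (z - ζ) ^ (n - k) * (z - ζ) * (z - ζ) ^ k := by
      rw [mul_right_comm, ← pow_add, Nat.sub_add_cancel hk, pow_succ]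
    have haz : (aPoly A).eval z = (z - ζ) ^ (n - k) * (z - ζ) * (z - ζ) ^ k * a₁.eval z := by
      rw [ha₁, hn, eval_mul, eval_pow, eval_sub, eval_X, eval_C, hpow]
    have hwz : weight A u φ z * (aPoly A).eval z = u z * (aPoly A).eval (φ z) *
        ∏ ξ ∈ interiorZeros A u φ, (φ z - ntLimit φ ξ) ^ mult A ξ := by
      rw [weight, div_mul_cancel₀ _ ha]
    simp only [Function.comp_apply]
    rw [div_mul_eq_mul_div, div_mul_eq_mul_div, ← hwz, eq_div_iff (pow_ne_zero _ hz0), haz]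
    ring

end DBR

end


theorem theorem4p2 (b A : RatFunc ℂ) (hb : DBR.IsSymbol b) (hA : DBR.IsPythagoreanMate b A)
    (u φ : ℂ → ℂ) (hφ : DifferentiableOn ℂ φ DBR.disc) (hφD : Set.MapsTo φ DBR.disc DBR.disc)
    (H1 : DBR.MemHb b u) (H2 : DBR.MemHb b (fun z => u z * φ z))
    (hw : DBR.MemH2 (DBR.weight A u φ)) :
    DBR.ConditionNC A u φ := by
  intro ζ hζ
  obtain ⟨hnum, hroot, hnorm⟩ := DBR.mem_circleZeros hζ
  obtain ⟨n, hn⟩ : ∃ n, DBR.mult A ζ = n + 1 :=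
    Nat.exists_eq_succ_of_ne_zero ((rootMultiplicity_pos hnum).2 hroot).ne'
  obtain ⟨p, hp⟩ := H1.exists_isLittleO hb hA.norm_sq_add hζ hn
  obtain ⟨q, hq⟩ := H2.exists_isLittleO hb hA.norm_sq_add hζ hn
  obtain ⟨h, -, hu⟩ := H1
  have hder : ∀ l ≤ n, DBR.HasNTLimit (iteratedDeriv l u) ζ ((derivative^[l] p).eval ζ) :=
    fun l hl => DBR.hasNTLimit_iteratedDeriv_of_isLittleO hu.differentiableOn hnorm hp hl
  rw [hn]
  -- The derivatives of p at ζ up to order n = m - 1 are the limits of those of u, so they decide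
  -- between the two alternatives.
  by_cases hvan : ∀ l ≤ n, (derivative^[l] p).eval ζ = 0
  · refine Or.inl fun l hl => ?_
    rw [← hvan l (Nat.lt_succ_iff.1 hl)]
    exact hder l (Nat.lt_succ_iff.1 hl)
  push Not at hvan
  obtain ⟨l, hl, hne⟩ := hvan
  refine Or.inr ⟨⟨l, Nat.lt_succ_iff.2 hl, _, hne, hder l hl⟩, ?_⟩
  have hp0 : p ≠ 0 := by
    rintro rfl
    simp at hne
  -- The order k of p at ζ is at most n, since a larger one would make all derivatives up to order n
  -- vanish.
  have hk : p.rootMultiplicity ζ ≤ n := by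
    by_contra! hlt
    exact hne (isRoot_iterate_derivative_of_lt_rootMultiplicity (hl.trans_lt hlt))
  obtain ⟨p₁, hp₁, hndvd⟩ := exists_eq_pow_rootMultiplicity_mul_and_not_dvd p hp0 ζ
  rw [dvd_iff_isRoot] at hndvd
  have hp' := hp
  rw [hp₁] at hp'
  obtain ⟨L, hL, hL1⟩ := DBR.exists_hasNTLimit hφD hnorm hk hndvd hp' hq
  refine ⟨L, hL, ?_⟩
  by_cases hLD : L ∈ DBR.disc
  · exact Or.inl hLD
  · exact Or.inr (DBR.eval_aPoly_eq_zero_of_memH2 hw hζ hn hk hndvd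
      (DBR.tendsto_div_pow_of_isLittleO hnorm hk (hp' 2)) hL
      (not_lt.1 fun h => hLD (DBR.mem_disc.2 h)))
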